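/- Let $p\ge 1$, $n\ge 0$, $\alpha\in(0,1]$ and $\lambda_1,\dots,\lambda_p>0$. Let $Q=(q_{ij})$ be the transition matrix of a Markov chain on $E=\{1,\dots,p+1\}$ whose states $1,\dots,p$ are transient with $q_{ii}=0$, and whose state $p+1$ is absorbing. Let $(C_m)_{m\ge 0}$ be a Markov chain on $E$ with transition matrix $Q$ and initial distribution $\pi=(\pi_1,\dots,\pi_p)$ concentrated on $\{1,\dots,p\}$, i.e. $\pi_i\ge 0$, $\sum_{i=1}^p\pi_i=1$. For $i=1,\dots,p$ and $m\ge 1$ let $T^i_m$ be random variables that are mutually independent, independent of the chain $(C_m)$, and such that $T^i_m$ has the Mittag-Leffler distribution $\mathrm{ML}(\alpha,\lambda_i)$, i.e. has density $$f(x)=\lambda_i x^{\alpha-1}E_{\alpha,\alpha}(-\lambda_i x^\alpha)\quad (x>0),\qquad E_{\alpha,\beta}(z)=\sum_{k=0}^\infty \frac{z^k}{\Gamma(\alpha k+\beta)}.$$ Put $T^{p+1}_m=\infty$, $S_m=\sum_{l=1}^m T^{C_{l-1}}_l$ ($S_0=0$), let $X_t=C_{m-1}$ for $S_{m-1}\le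 t<S_m$, $m\ge 1$, be the associated semi-Markov process, and let $\tau=\inf\{t\ge 0: X_t=p+1\}$ be its absorption time. Let $R=(r_{ik})$ be a $p\times n$ matrix with non-negative entries and put $$Y_k=\int_0^\tau\sum_{i=1}^p r_{ik}1\{X_t=i\}\,dt,\qquad k=1,\dots,n.$$ Let $T$ be the $p\times p$ matrix with $T_{ii}=-\lambda_i$ and $T_{ij}=\lambda_i q_{ij}$ for $i\ne j$, and let $t$ be the column vector with entries $t_i=\lambda_i q_{i,p+1}$. Then $\tau<\infty$ almost surely, $Y=(Y_1,\dots,Y_n)$ is an (almost everywhere defined) random vector, and for every $\theta=(\theta_1,\dots,\theta_n)\in[0,\infty)^n$ the matrix $\Delta(R\theta)^\alpha-T$ is invertible and $$\mathbb E\big(e^{-\langle Y,\theta\rangle}\big)=\pi\,\big(\Delta(R\theta)^\alpha-T\big)^{-1}t,$$ where $\Delta(R\theta)^\alpha$ is the diagonal matrix with diagonal entries $\big(\sum_{k=1}^n r_{ik}\theta_k\big)^\alpha$, $i=1,\dots,p$. -/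

import Mathlib

open MeasureTheory ProbabilityTheory
open scoped ENNReal BigOperators

namespace FracPH

/-! ### Mittag-Leffler distributions -/

/-- The two-parameter Mittag-Leffler function `E_{a,b}(z) = ∑ₖ zᵏ / Γ(a k + b)` (real argument). -/
noncomputable def mittagLeffler (a b z : ℝ) : ℝ :=
  ∑' k : ℕ, z ^ k / Real.Gamma (a * k + b)

/-- The density of the Mittag-Leffler distribution `ML(a, l)`, equal to
`l x^(a-1) E_{a,a}(-l x^a)` for `x > 0` and to `0` for `x ≤ 0`. -/
noncomputable def mlDensity (a l x : ℝ) : ℝ :=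
  if 0 < x then l * x ^ (a - 1) * mittagLeffler a a (-l * x ^ a) else 0

/-- The real random variable `Z` has the (real-valued) probability density `f`:
`f` is integrable and `P(Z ∈ B) = ∫_B f(x) dx` for every Borel set `B`. -/
def HasDensity {Ω : Type*} [MeasurableSpace Ω] (μ : Measure Ω) (Z : Ω → ℝ) (f : ℝ → ℝ) : Prop :=
  Integrable f ∧ ∀ B : Set ℝ, MeasurableSet B → μ.real (Z ⁻¹' B) = ∫ x in B, f x

/-- `Z` is `ML(a, l)`-distributed. -/
def IsMittagLeffler {Ω : Type*} [MeasurableSpace Ω] (μ : Measure Ω) (Z : Ω → ℝ) (a l : ℝ) : Prop :=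
  Measurable Z ∧ HasDensity μ Z (mlDensity a l)

/-! ### The embedded Markov chain

The state space `E = {1, …, p, p+1}` is `Fin (p + 1)`; the states `1, …, p` are the
`Fin.castSucc i` for `i : Fin p`, and `p + 1` is `Fin.last p`. -/

/-- `firstPassage Q j n i` is the probability that the chain with transition matrix `Q` started
in `i` visits `j` at time `n + 1` and at none of the times `1, …, n`. -/
noncomputable def firstPassage {m : ℕ} (Q : Matrix (Fin m) (Fin m) ℝ) (j : Fin m) :
    ℕ → Fin m → ℝ
  | 0, i => Q i j
  | n + 1, i => ∑ k ∈ Finset.univ.erase j, Q i k * firstPassage Q j n k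

/-- The state `i` is transient: the probability of ever returning to `i` is less than one. -/
def IsTransient {m : ℕ} (Q : Matrix (Fin m) (Fin m) ℝ) (i : Fin m) : Prop :=
  ∑' n : ℕ, ENNReal.ofReal (firstPassage Q i n i) < 1

/-- `Q` is the transition matrix of a Markov chain on `{1, …, p + 1}` whose first `p` states are
transient and have `q_{ii} = 0`, and whose state `p + 1` is absorbing. -/
structure IsAbsorbingTransitionMatrix {p : ℕ} (Q : Matrix (Fin (p + 1)) (Fin (p + 1)) ℝ) :
    Prop where
  nonneg : ∀ i j, 0 ≤ Q i j
  row_sum : ∀ i, ∑ j, Q i j = 1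
  absorbing : Q (Fin.last p) (Fin.last p) = 1
  transient : ∀ i : Fin p, IsTransient Q i.castSucc
  diag_zero : ∀ i : Fin p, Q i.castSucc i.castSucc = 0

/-- `C = (C₀, C₁, …)` is a Markov chain on `{1, …, m}` with initial distribution `v` and
transition matrix `Q`. -/
def IsMarkovChain {Ω : Type*} [MeasurableSpace Ω] (μ : Measure Ω) {m : ℕ}
    (v : Fin m → ℝ) (Q : Matrix (Fin m) (Fin m) ℝ) (C : ℕ → Ω → Fin m) : Prop :=
  (∀ n, Measurable (C n)) ∧
    ∀ (n : ℕ) (x : ℕ → Fin m),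
      μ.real {ω | ∀ k ≤ n, C k ω = x k} = v (x 0) * ∏ k ∈ Finset.range n, Q (x k) (x (k + 1))

/-- The initial distribution on `{1, …, p + 1}` which is `w` on `{1, …, p}` and gives no mass
to `p + 1`. -/
noncomputable def initialLaw {p : ℕ} (w : Fin p → ℝ) : Fin (p + 1) → ℝ :=
  Fin.lastCases 0 w

/-! ### The semi-Markov process -/

section Construction

variable {Ω : Type*} {p : ℕ} (C : ℕ → Ω → Fin (p + 1)) (Z : Fin p → ℕ → Ω → ℝ)

/-- The time spent in the state `C n` reached by the `n`-th jump: it is `Z i n` if `C n` is the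
transient state `i`, and infinite if `C n` is absorbing. -/
noncomputable def holdingTime (n : ℕ) (ω : Ω) : ℝ≥0∞ :=
  Fin.lastCases (motive := fun _ => ℝ≥0∞) ∞ (fun i => ENNReal.ofReal (Z i n ω)) (C n ω)

/-- The time `S n` of the `n`-th jump, `S 0 = 0`. -/
noncomputable def jumpTime (n : ℕ) (ω : Ω) : ℝ≥0∞ :=
  ∑ k ∈ Finset.range n, holdingTime C Z k ω

/-- The label in `{1, 2, …}` of a state: the labels of `Fin (p + 1)` are `1, …, p + 1`. -/
def label {m : ℕ} (i : Fin m) : ℕ := (i : ℕ) + 1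

open Classical in
/-- The process `X_t = ∑_{n ≥ 1} C_{n-1} 1{S_{n-1} ≤ t < S_n}`, `t ≥ 0`, with values in the labels
`1, …, p + 1`. At most one summand is nonzero. -/
noncomputable def semiMarkov (t : ℝ) (ω : Ω) : ℕ :=
  ∑' n : ℕ, if jumpTime C Z n ω ≤ ENNReal.ofReal t ∧ ENNReal.ofReal t < jumpTime C Z (n + 1) ω
    then label (C n ω) else 0

/-- The absorption time `inf {t ≥ 0 : X_t = p + 1}` (infinite if there is no such `t`). -/
noncomputable def absorptionTime (ω : Ω) : ℝ≥0∞ :=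
  ⨅ (t : ℝ) (_ : 0 ≤ t ∧ semiMarkov C Z t ω = label (Fin.last p)), ENNReal.ofReal t

/-- The total reward `∫₀^τ ∑ᵢ r_{ik} 1{X_t = i} dt`, where `τ` is the absorption time. -/
noncomputable def totalReward {n : ℕ} (R : Matrix (Fin p) (Fin n) ℝ) (k : Fin n) (ω : Ω) : ℝ :=
  ∫ t in (0 : ℝ)..(absorptionTime C Z ω).toReal,
    ∑ i : Fin p, R i k * (if semiMarkov C Z t ω = label i then 1 else 0)

end Construction

/-! ### The intensity matrix and its blocks -/

/-- The intensity matrix: `λᵢ q_{ij}` off the diagonal and `-λᵢ` on it in the rows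
`i ≤ p`; the row `p + 1` vanishes. -/
noncomputable def intensityMatrix {p : ℕ} (lam : Fin p → ℝ)
    (Q : Matrix (Fin (p + 1)) (Fin (p + 1)) ℝ) : Matrix (Fin (p + 1)) (Fin (p + 1)) ℝ :=
  Matrix.of fun i j => Fin.lastCases (motive := fun _ => ℝ) 0
    (fun i' => if i'.castSucc = j then -lam i' else lam i' * Q i'.castSucc j) i

/-- The block `T` of the intensity matrix (rows and columns `1, …, p`). -/
noncomputable def subIntensity {p : ℕ} (lam : Fin p → ℝ)
    (Q : Matrix (Fin (p + 1)) (Fin (p + 1)) ℝ) : Matrix (Fin p) (Fin p) ℝ :=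
  (intensityMatrix lam Q).submatrix Fin.castSucc Fin.castSucc

/-- The block `t` of the intensity matrix (rows `1, …, p`, column `p + 1`). -/
noncomputable def exitRates {p : ℕ} (lam : Fin p → ℝ)
    (Q : Matrix (Fin (p + 1)) (Fin (p + 1)) ℝ) : Fin p → ℝ :=
  fun i => intensityMatrix lam Q i.castSucc (Fin.last p)

end FracPH

open FracPH

/-!
Once the chain is absorbed, `exp (-⟨Y, θ⟩)` is the product over the visited transient states `i` of
`exp (-(R θ)ᵢ Z)`, where `Z` is the holding time. Integrating over the holding times turns the
factors into their Laplace transforms `φ i = λᵢ / (λᵢ + (R θ)ᵢ ^ α)`, and summing over the paths of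
the chain identifies the expectation as the limit of `π (Δ(φ) Q)ⁿ 1`, with
`φ = 1` at the absorbing state.

The entries of `(Δ(φ) Q)ⁿ` are dominated by those of `Qⁿ`, and `(Qⁿ)ᵢⱼ → 0` for transient `j` by the
renewal equation. So only the last entry of a vector matters in the limit, while a vector `(x, c)`
is fixed by `Δ(φ) Q` exactly when `(D - T) x = c t`, where `D = Δ(Rθ)^α`. With `c = 0` this shows
that `D - T` is injective, and with `c = 1` that the limit is `π (D - T)⁻¹ t`.

For the Mittag-Leffler law, integrating the series termwise gives `λ / (λ + u ^ α)` only for large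
`u`; both sides are analytic on `(0, ∞)`, so they agree there.
-/

namespace FracPH

open Filter Topology
open scoped Matrix

section Renewal

open Finset.HasAntidiagonal (antidiagonal)

theorem summable_of_renewal {f u : ℕ → ℝ} (hf0 : ∀ n, 0 ≤ f n) (hf : Summable f)
    (hf1 : ∑' n, f n < 1) (hu0 : ∀ n, 0 ≤ u n)
    (hu : ∀ n, u (n + 1) = ∑ k ∈ antidiagonal n, f k.1 * u k.2) : Summable u := by
  have hshift (N : ℕ) :
      ∑ n ∈ Finset.range N, u (n + 1) ≤ (∑' n, f n) * ∑ n ∈ Finset.range N, u n :=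
    calc ∑ n ∈ Finset.range N, u (n + 1)
        = ∑ a ∈ Finset.range N, ∑ b ∈ Finset.range (N - a), f a * u b := by
          simp_rw [hu, Finset.Nat.sum_antidiagonal_eq_sum_range_succ fun a b => f a * u b]
          exact Finset.sum_range_diag_flip N fun a b => f a * u b
      _ ≤ ∑ a ∈ Finset.range N, ∑ b ∈ Finset.range N, f a * u b :=
          Finset.sum_le_sum fun a _ => Finset.sum_le_sum_of_subset_of_nonneg
            (Finset.range_mono (Nat.sub_le N a)) fun b _ _ => mul_nonneg (hf0 a) (hu0 b)
      _ = (∑ a ∈ Finset.range N, f a) * ∑ b ∈ Finset.range N, u b :=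
          (Finset.sum_mul_sum ..).symm
      _ ≤ (∑' n, f n) * ∑ n ∈ Finset.range N, u n :=
          mul_le_mul_of_nonneg_right (hf.sum_le_tsum _ fun a _ => hf0 a)
            (Finset.sum_nonneg fun b _ => hu0 b)
  refine summable_of_sum_range_le (c := u 0 / (1 - ∑' n, f n)) hu0 fun N => ?_
  rw [le_div_iff₀ (by linarith)]
  linarith [hshift N, hu0 N, Finset.sum_range_succ u N, Finset.sum_range_succ' u N]

variable {m : ℕ} {Q : Matrix (Fin m) (Fin m) ℝ}

theorem firstPassage_nonneg (hQ : ∀ i j, 0 ≤ Q i j) (j : Fin m) (n : ℕ) (i : Fin m) :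
    0 ≤ firstPassage Q j n i := by
  induction n generalizing i with
  | zero => exact hQ i j
  | succ n ih => exact Finset.sum_nonneg fun k _ => mul_nonneg (hQ i k) (ih k)

theorem sum_range_firstPassage_le_one (hQ : ∀ i j, 0 ≤ Q i j) (hQ1 : ∀ i, ∑ j, Q i j ≤ 1)
    (j : Fin m) (N : ℕ) (i : Fin m) : ∑ n ∈ Finset.range N, firstPassage Q j n i ≤ 1 := by
  induction N generalizing i with
  | zero => simp
  | succ N ih =>
    calc ∑ n ∈ Finset.range (N + 1), firstPassage Q j n i
        = ∑ k ∈ Finset.univ.erase j, Q i k * ∑ n ∈ Finset.range N, firstPassage Q j n k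
            + Q i j := by
          simp only [Finset.sum_range_succ', firstPassage, Finset.mul_sum]
          rw [Finset.sum_comm]
      _ ≤ ∑ k ∈ Finset.univ.erase j, Q i k + Q i j := by
          gcongr with k
          exact mul_le_of_le_one_right (hQ i k) (ih k)
      _ ≤ 1 := (Finset.sum_erase_add _ _ (Finset.mem_univ j)).trans_le (hQ1 i)

theorem summable_firstPassage (hQ : ∀ i j, 0 ≤ Q i j) (hQ1 : ∀ i, ∑ j, Q i j ≤ 1)
    (i j : Fin m) : Summable fun n => firstPassage Q j n i :=
  summable_of_sum_range_le (firstPassage_nonneg hQ j · i)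
    (sum_range_firstPassage_le_one hQ hQ1 j · i)

theorem IsTransient.tsum_firstPassage_lt_one (hQ : ∀ i j, 0 ≤ Q i j)
    (hQ1 : ∀ i, ∑ j, Q i j ≤ 1) {i : Fin m} (hi : IsTransient Q i) :
    ∑' n, firstPassage Q i n i < 1 := by
  rwa [IsTransient, ← ENNReal.ofReal_tsum_of_nonneg (firstPassage_nonneg hQ i · i)
    (summable_firstPassage hQ hQ1 i i), ENNReal.ofReal_lt_one] at hi

theorem pow_succ_apply_eq_sum_firstPassage (Q : Matrix (Fin m) (Fin m) ℝ) (i j : Fin m)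
    (n : ℕ) :
    (Q ^ (n + 1)) j i = ∑ k ∈ antidiagonal n, firstPassage Q i k.1 j * (Q ^ k.2) i i := by
  induction n generalizing j with
  | zero => simp [firstPassage]
  | succ n ih =>
    rw [pow_succ', Matrix.mul_apply, ← Finset.add_sum_erase _ _ (Finset.mem_univ i),
      Finset.Nat.sum_antidiagonal_succ]
    simp only [firstPassage, ih, Finset.sum_mul, Finset.mul_sum, mul_assoc]
    rw [Finset.sum_comm]

theorem IsTransient.tendsto_pow_apply (hQ : ∀ i j, 0 ≤ Q i j) (hQ1 : ∀ i, ∑ j, Q i j ≤ 1)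
    {i : Fin m} (hi : IsTransient Q i) (j : Fin m) :
    Tendsto (fun n => (Q ^ n) j i) atTop (𝓝 0) := by
  have hpow (n : ℕ) : 0 ≤ (Q ^ n) i i := Matrix.pow_apply_nonneg hQ n i i
  have hreturn : Summable fun n => (Q ^ n) i i :=
    summable_of_renewal (firstPassage_nonneg hQ i · i) (summable_firstPassage hQ hQ1 i i)
      (hi.tsum_firstPassage_lt_one hQ hQ1) hpow (pow_succ_apply_eq_sum_firstPassage Q i i)
  have hvisit : Summable fun n => (Q ^ (n + 1)) j i := by
    simp_rw [pow_succ_apply_eq_sum_firstPassage Q i j]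
    exact (summable_norm_sum_mul_antidiagonal_of_summable_norm
      (summable_firstPassage hQ hQ1 j i).norm hreturn.norm).of_norm
  exact (tendsto_add_atTop_iff_nat 1).1 hvisit.tendsto_atTop_zero

end Renewal

theorem abs_pow_apply_le_pow_apply {ι : Type*} [Fintype ι] [DecidableEq ι] {A B : Matrix ι ι ℝ}
    (hAB : ∀ i j, |A i j| ≤ B i j) (n : ℕ) (i j : ι) : |(A ^ n) i j| ≤ (B ^ n) i j := by
  induction n generalizing j with
  | zero => by_cases hij : i = j <;> simp [hij]
  | succ n ih =>
    rw [pow_succ, pow_succ, Matrix.mul_apply, Matrix.mul_apply]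
    refine (Finset.abs_sum_le_sum_abs _ _).trans (Finset.sum_le_sum fun k _ => ?_)
    rw [abs_mul]
    exact mul_le_mul (ih k) (hAB k j) (abs_nonneg _) ((abs_nonneg _).trans (ih k))

theorem pow_mulVec_eq_self {ι R : Type*} [Fintype ι] [DecidableEq ι] [Semiring R]
    {A : Matrix ι ι R} {v : ι → R} (h : A *ᵥ v = v) (n : ℕ) : A ^ n *ᵥ v = v := by
  induction n with
  | zero => rw [pow_zero, Matrix.one_mulVec]
  | succ n ih => rw [pow_succ, ← Matrix.mulVec_mulVec, h, ih]

section ExtendLast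

variable {p : ℕ} {β : Type*}

/-- The function on the states `1, …, p + 1` which is `f` on the transient states `1, …, p` and
has the value `c` at the absorbing state `p + 1`. -/
def extendLast (f : Fin p → β) (c : β) : Fin (p + 1) → β := Fin.lastCases c f

@[simp]
theorem extendLast_castSucc (f : Fin p → β) (c : β) (i : Fin p) :
    extendLast f c i.castSucc = f i := Fin.lastCases_castSucc ..

@[simp]
theorem extendLast_last (f : Fin p → β) (c : β) : extendLast f c (Fin.last p) = c :=
  Fin.lastCases_last ..

theorem abs_extendLast_one_le_one {f : Fin p → ℝ} (hf : ∀ i, |f i| ≤ 1) (j : Fin (p + 1)) :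
    |extendLast f 1 j| ≤ 1 := by
  cases j using Fin.lastCases with
  | last => simp
  | cast i => simpa using hf i

theorem measurable_extendLast {Ω : Type*} [MeasurableSpace Ω] [MeasurableSpace β]
    {f : Fin p → Ω → β} (hf : ∀ i, Measurable (f i)) (c : β) (j : Fin (p + 1)) :
    Measurable fun ω => extendLast (f · ω) c j := by
  cases j using Fin.lastCases with
  | last => simp
  | cast i => simpa using hf i

theorem initialLaw_dotProduct_extendLast (w v : Fin p → ℝ) (c : ℝ) :
    initialLaw w ⬝ᵥ extendLast v c = w ⬝ᵥ v := by
  simp [dotProduct, Fin.sum_univ_castSucc, initialLaw]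

end ExtendLast

section AbsorbingMatrix

variable {p : ℕ} {Q : Matrix (Fin (p + 1)) (Fin (p + 1)) ℝ} {lam d : Fin p → ℝ}

theorem IsAbsorbingTransitionMatrix.last_apply_of_ne (hQ : IsAbsorbingTransitionMatrix Q)
    {j : Fin (p + 1)} (hj : j ≠ Fin.last p) : Q (Fin.last p) j = 0 := by
  have hrow := hQ.row_sum (Fin.last p)
  rw [← Finset.add_sum_erase _ _ (Finset.mem_univ (Fin.last p)), hQ.absorbing, add_eq_left,
    Finset.sum_eq_zero_iff_of_nonneg fun k _ => hQ.nonneg _ k] at hrow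
  exact hrow j (Finset.mem_erase.2 ⟨hj, Finset.mem_univ j⟩)

theorem IsAbsorbingTransitionMatrix.mulVec_last (hQ : IsAbsorbingTransitionMatrix Q)
    (v : Fin (p + 1) → ℝ) : (Q *ᵥ v) (Fin.last p) = v (Fin.last p) := by
  rw [Matrix.mulVec, dotProduct, Finset.sum_eq_single (Fin.last p)
    (fun j _ hj => by rw [hQ.last_apply_of_ne hj, zero_mul]) (by simp), hQ.absorbing, one_mul]

theorem IsAbsorbingTransitionMatrix.tendsto_pow_apply_castSucc
    (hQ : IsAbsorbingTransitionMatrix Q) (i : Fin (p + 1)) (j : Fin p) :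
    Tendsto (fun n => (Q ^ n) i j.castSucc) atTop (𝓝 0) :=
  (hQ.transient j).tendsto_pow_apply hQ.nonneg (fun i => (hQ.row_sum i).le) i

theorem IsAbsorbingTransitionMatrix.tendsto_pow_mulVec (hQ : IsAbsorbingTransitionMatrix Q)
    {φ : Fin (p + 1) → ℝ} (hφ : ∀ j, |φ j| ≤ 1) {g : Fin (p + 1) → ℝ} (hg : g (Fin.last p) = 0) :
    Tendsto (fun n => (Matrix.diagonal φ * Q) ^ n *ᵥ g) atTop (𝓝 0) := by
  have hentry (i j : Fin (p + 1)) : |(Matrix.diagonal φ * Q) i j| ≤ Q i j := by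
    rw [Matrix.diagonal_mul, abs_mul, abs_of_nonneg (hQ.nonneg i j)]
    exact mul_le_of_le_one_left (hQ.nonneg i j) (hφ i)
  refine tendsto_pi_nhds.2 fun i => ?_
  simp only [Matrix.mulVec, dotProduct, Fin.sum_univ_castSucc, hg, mul_zero, add_zero]
  have hterm (j : Fin p) : Tendsto
      (fun n => ((Matrix.diagonal φ * Q) ^ n) i j.castSucc * g j.castSucc) atTop (𝓝 0) := by
    rw [← zero_mul (g j.castSucc)]
    exact (squeeze_zero_norm (fun n => abs_pow_apply_le_pow_apply hentry n i j.castSucc)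
      (hQ.tendsto_pow_apply_castSucc i j)).mul_const _
  simpa using tendsto_finsetSum Finset.univ fun j _ => hterm j

theorem IsAbsorbingTransitionMatrix.subIntensity_apply (hQ : IsAbsorbingTransitionMatrix Q)
    (i j : Fin p) : subIntensity lam Q i j
      = lam i * Q i.castSucc j.castSucc - Matrix.diagonal lam i j := by
  by_cases hij : i = j
  · subst hij
    simp [subIntensity, intensityMatrix, hQ.diag_zero]
  · simp [subIntensity, intensityMatrix, hij]

theorem IsAbsorbingTransitionMatrix.subIntensity_mulVec (hQ : IsAbsorbingTransitionMatrix Q)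
    (v : Fin p → ℝ) (i : Fin p) :
    (subIntensity lam Q *ᵥ v) i
      = lam i * ∑ j : Fin p, Q i.castSucc j.castSucc * v j - lam i * v i := by
  rw [← Matrix.mulVec_diagonal lam v i]
  simp only [Matrix.mulVec, dotProduct, hQ.subIntensity_apply, sub_mul, Finset.sum_sub_distrib,
    Finset.mul_sum, mul_assoc]

theorem exitRates_apply (i : Fin p) :
    exitRates lam Q i = lam i * Q i.castSucc (Fin.last p) := by
  simp [exitRates, intensityMatrix, Fin.castSucc_ne_last]

/-- The Laplace transforms of the holding times in the states `1, …, p + 1`, at a point where the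
one in the transient state `i` is `lam i / (lam i + d i)`. The absorbing state, where no reward is
earned, gets the factor `1`. -/
noncomputable def holdingLaplace (lam d : Fin p → ℝ) : Fin (p + 1) → ℝ :=
  extendLast (fun i => lam i / (lam i + d i)) 1

theorem IsAbsorbingTransitionMatrix.mulVec_extendLast_eq_self_iff
    (hQ : IsAbsorbingTransitionMatrix Q) (hd : ∀ i, lam i + d i ≠ 0) (v : Fin p → ℝ) (c : ℝ) :
    (Matrix.diagonal (holdingLaplace lam d) * Q) *ᵥ extendLast v c = extendLast v c ↔
      (Matrix.diagonal d - subIntensity lam Q) *ᵥ v = c • exitRates lam Q := by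
  rw [← Matrix.mulVec_mulVec, funext_iff, funext_iff, Fin.forall_fin_succ']
  simp only [Matrix.mulVec_diagonal, hQ.mulVec_last, holdingLaplace, extendLast_castSucc,
    extendLast_last, one_mul, and_true]
  refine forall_congr' fun i => ?_
  rw [Matrix.sub_mulVec, Pi.sub_apply, Matrix.mulVec_diagonal, hQ.subIntensity_mulVec,
    Pi.smul_apply, exitRates_apply, smul_eq_mul, div_mul_eq_mul_div, div_eq_iff (hd i)]
  simp only [Matrix.mulVec, dotProduct, Fin.sum_univ_castSucc, extendLast_castSucc,
    extendLast_last]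
  constructor <;> intro h <;> linarith

theorem IsAbsorbingTransitionMatrix.isUnit_diagonal_sub_subIntensity
    (hQ : IsAbsorbingTransitionMatrix Q) (hd : ∀ i, lam i + d i ≠ 0)
    (hle : ∀ i, |lam i / (lam i + d i)| ≤ 1) :
    IsUnit (Matrix.diagonal d - subIntensity lam Q) := by
  rw [← Matrix.mulVec_injective_iff_isUnit, ← Matrix.coe_mulVecLin, injective_iff_map_eq_zero]
  intro v hv
  have hfixed := pow_mulVec_eq_self ((hQ.mulVec_extendLast_eq_self_iff hd v 0).2
    (by rwa [zero_smul, ← Matrix.mulVecLin_apply]))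
  have hzero := hQ.tendsto_pow_mulVec (abs_extendLast_one_le_one hle) (extendLast_last v 0)
  have hv0 : extendLast v 0 = 0 :=
    tendsto_nhds_unique tendsto_const_nhds (hzero.congr hfixed)
  ext i
  simpa using congrFun hv0 i.castSucc

theorem IsAbsorbingTransitionMatrix.tendsto_pow_mulVec_one
    (hQ : IsAbsorbingTransitionMatrix Q) (hd : ∀ i, lam i + d i ≠ 0)
    (hle : ∀ i, |lam i / (lam i + d i)| ≤ 1) :
    Tendsto (fun n => (Matrix.diagonal (holdingLaplace lam d) * Q) ^ n *ᵥ 1) atTop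
      (𝓝 (extendLast ((Matrix.diagonal d - subIntensity lam Q)⁻¹ *ᵥ exitRates lam Q) 1)) := by
  set h := extendLast ((Matrix.diagonal d - subIntensity lam Q)⁻¹ *ᵥ exitRates lam Q) 1
  have hfixed := pow_mulVec_eq_self ((hQ.mulVec_extendLast_eq_self_iff hd
    ((Matrix.diagonal d - subIntensity lam Q)⁻¹ *ᵥ exitRates lam Q) 1).2 (by
      rw [Matrix.mulVec_mulVec, Matrix.mul_nonsing_inv _ ((Matrix.isUnit_iff_isUnit_det _).1
        (hQ.isUnit_diagonal_sub_subIntensity hd hle)), Matrix.one_mulVec, one_smul]))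
  have hdiff := hQ.tendsto_pow_mulVec (φ := holdingLaplace lam d) (g := 1 - h)
    (abs_extendLast_one_le_one hle) (by simp [h])
  simpa [Matrix.mulVec_sub, hfixed, h] using hdiff.add_const h

end AbsorbingMatrix

section MittagLeffler

variable {a b l s u z : ℝ}

theorem integrableOn_rpow_mul_exp_neg_mul (hs : 0 < s) (hu : 0 < u) :
    IntegrableOn (fun x : ℝ => x ^ (s - 1) * Real.exp (-(u * x))) (Set.Ioi 0) := by
  simpa using integrableOn_rpow_mul_exp_neg_mul_rpow (p := 1) (by linarith) one_pos hu

theorem integral_rpow_div_Gamma_mul_exp_neg_mul (hs : 0 < s) (hu : 0 < u) :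
    ∫ x in Set.Ioi 0, (Real.Gamma s)⁻¹ * (x ^ (s - 1) * Real.exp (-(u * x))) = (1 / u) ^ s := by
  rw [integral_const_mul, Real.integral_rpow_mul_exp_neg_mul_Ioi hs hu,
    mul_comm ((1 / u) ^ s), inv_mul_cancel_left₀ (Real.Gamma_pos_of_pos hs).ne']

theorem rpow_mul_mittagLeffler_mul_eq_tsum {x : ℝ} (hx : 0 < x) (a b z c : ℝ) :
    x ^ (b - 1) * mittagLeffler a b (z * x ^ a) * c
      = ∑' k : ℕ, z ^ k * ((Real.Gamma (a * k + b))⁻¹ * (x ^ (a * k + b - 1) * c)) := by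
  rw [mittagLeffler, ← tsum_mul_left, ← tsum_mul_right]
  refine tsum_congr fun k => ?_
  rw [add_sub_assoc, Real.rpow_add hx, Real.rpow_mul hx.le, Real.rpow_natCast, mul_pow]
  ring

theorem integral_rpow_mul_mittagLeffler_mul_exp_neg_mul (ha : 0 < a) (hb : 0 < b) (hu : 0 < u)
    (hz : |z| < u ^ a) :
    ∫ x in Set.Ioi 0, x ^ (b - 1) * mittagLeffler a b (z * x ^ a) * Real.exp (-(u * x))
      = u ^ (a - b) / (u ^ a - z) := by
  have hua : 0 < u ^ a := Real.rpow_pos_of_pos hu a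
  have hs (k : ℕ) : 0 < a * k + b := by positivity
  let F (z : ℝ) (k : ℕ) (x : ℝ) : ℝ :=
    z ^ k * ((Real.Gamma (a * k + b))⁻¹ * (x ^ (a * k + b - 1) * Real.exp (-(u * x))))
  have hF_int (k : ℕ) : IntegrableOn (F z k) (Set.Ioi 0) :=
    ((integrableOn_rpow_mul_exp_neg_mul (hs k) hu).const_mul _).const_mul _
  have hF (z : ℝ) (k : ℕ) : ∫ x in Set.Ioi 0, F z k x = u ^ (-b) * (z / u ^ a) ^ k := by
    rw [integral_const_mul, integral_rpow_div_Gamma_mul_exp_neg_mul (hs k) hu, one_div,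
      Real.inv_rpow hu.le, Real.rpow_add hu, Real.rpow_mul hu.le, Real.rpow_natCast,
      Real.rpow_neg hu.le, div_pow, mul_inv]
    ring
  have hF_norm (k : ℕ) : ∫ x in Set.Ioi 0, ‖F z k x‖ = u ^ (-b) * (|z| / u ^ a) ^ k := by
    rw [← hF]
    refine setIntegral_congr_fun measurableSet_Ioi fun x hx => ?_
    have hnonneg : 0 ≤ (Real.Gamma (a * k + b))⁻¹ * (x ^ (a * k + b - 1) * Real.exp (-(u * x))) :=
      mul_nonneg (inv_nonneg.2 (Real.Gamma_nonneg_of_nonneg (hs k).le))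
        (mul_nonneg (Real.rpow_nonneg (le_of_lt hx) _) (Real.exp_nonneg _))
    rw [norm_mul, norm_pow, Real.norm_eq_abs, Real.norm_eq_abs, abs_of_nonneg hnonneg]
  have hsum := hasSum_integral_of_summable_integral_norm hF_int (by
    simp_rw [hF_norm]
    exact (summable_geometric_of_lt_one (by positivity) ((div_lt_one hua).2 hz)).mul_left _)
  have hgeom := (hasSum_geometric_of_abs_lt_one (r := z / u ^ a)
    (by rwa [abs_div, abs_of_pos hua, div_lt_one hua])).mul_left (u ^ (-b))
  calc ∫ x in Set.Ioi 0, x ^ (b - 1) * mittagLeffler a b (z * x ^ a) * Real.exp (-(u * x))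
      = ∫ x in Set.Ioi 0, ∑' k, F z k x :=
        setIntegral_congr_fun measurableSet_Ioi fun x hx =>
          rpow_mul_mittagLeffler_mul_eq_tsum hx a b z _
    _ = u ^ (-b) * (1 - z / u ^ a)⁻¹ := by
        simp_rw [hF] at hsum
        exact hsum.unique hgeom
    _ = u ^ (a - b) / (u ^ a - z) := by
        rw [one_sub_div hua.ne', inv_div, sub_eq_neg_add a b, Real.rpow_add hu, mul_div_assoc]

theorem integral_mlDensity_mul_exp_neg_mul (ha : 0 < a) (hu : 0 < u) (hl : |l| < u ^ a) :
    ∫ x, mlDensity a l x * Real.exp (-(u * x)) = l / (l + u ^ a) := by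
  have hindicator : (fun x => mlDensity a l x * Real.exp (-(u * x)))
      = (Set.Ioi 0).indicator fun x =>
        l * (x ^ (a - 1) * mittagLeffler a a (-l * x ^ a) * Real.exp (-(u * x))) := by
    ext x
    by_cases hx : 0 < x <;> simp [mlDensity, hx, mul_assoc]
  rw [hindicator, integral_indicator measurableSet_Ioi, integral_const_mul,
    integral_rpow_mul_mittagLeffler_mul_exp_neg_mul ha ha hu (by rwa [abs_neg]), sub_self,
    Real.rpow_zero, sub_neg_eq_add, add_comm, mul_one_div]

variable {Ω : Type*} [MeasurableSpace Ω] {μ : Measure Ω} {X : Ω → ℝ}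

theorem HasDensity.ae_nonneg {f : ℝ → ℝ} (h : HasDensity μ X f) : 0 ≤ᵐ[volume] f :=
  ae_nonneg_of_forall_setIntegral_nonneg h.1 fun s hs _ => h.2 s hs ▸ measureReal_nonneg

theorem HasDensity.map_eq [IsFiniteMeasure μ] {f : ℝ → ℝ} (h : HasDensity μ X f)
    (hX : Measurable X) :
    μ.map X = volume.withDensity fun x => ENNReal.ofReal (f x) := by
  refine Measure.ext fun s hs => ?_
  rw [Measure.map_apply hX hs, withDensity_apply _ hs, ← ofReal_integral_eq_lintegral_ofReal
    h.1.integrableOn (ae_restrict_of_ae h.ae_nonneg), ← h.2 s hs, ofReal_measureReal]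

theorem HasDensity.integral_comp [IsFiniteMeasure μ] {f g : ℝ → ℝ} (h : HasDensity μ X f)
    (hX : Measurable X) (hg : Measurable g) : ∫ ω, g (X ω) ∂μ = ∫ x, f x * g x := by
  rw [← integral_map hX.aemeasurable hg.aestronglyMeasurable, h.map_eq hX,
    integral_withDensity_eq_integral_toReal_smul₀ h.1.aemeasurable.ennreal_ofReal (by simp)]
  refine integral_congr_ae ?_
  filter_upwards [h.ae_nonneg] with x hx
  rw [ENNReal.toReal_ofReal hx, smul_eq_mul]

theorem IsMittagLeffler.ae_pos [IsFiniteMeasure μ] (h : IsMittagLeffler μ X a l) :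
    ∀ᵐ ω ∂μ, 0 < X ω := by
  have hnull : μ.real (X ⁻¹' Set.Iic 0) = 0 := (h.2.2 _ measurableSet_Iic).trans
    (setIntegral_eq_zero_of_forall_eq_zero fun x hx => if_neg (not_lt.2 hx))
  filter_upwards [measure_eq_zero_iff_ae_notMem.1 ((measureReal_eq_zero_iff).1 hnull)] with ω hω
  exact not_le.1 hω

theorem analyticOnNhd_integral_exp_neg_mul [IsFiniteMeasure μ] (hX : AEMeasurable X μ)
    (hX0 : 0 ≤ᵐ[μ] X) :
    AnalyticOnNhd ℝ (fun u => ∫ ω, Real.exp (-(u * X ω)) ∂μ) (Set.Ioi 0) := by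
  have hsub : Set.Ioi 0 ⊆ interior (integrableExpSet (-X) μ) := by
    refine isOpen_Ioi.subset_interior_iff.2 fun t ht => ?_
    refine Integrable.of_bound (C := 1) (by fun_prop) ?_
    filter_upwards [hX0] with ω hω
    rw [Real.norm_eq_abs, Real.abs_exp, Real.exp_le_one_iff]
    exact mul_nonpos_of_nonneg_of_nonpos (le_of_lt ht) (neg_nonpos.2 hω)
  have hmgf : (fun u => ∫ ω, Real.exp (-(u * X ω)) ∂μ) = mgf (-X) μ := by
    ext u
    simp [mgf]
  exact hmgf ▸ analyticOnNhd_mgf.mono hsub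

theorem IsMittagLeffler.integral_exp_neg_mul [IsProbabilityMeasure μ]
    (h : IsMittagLeffler μ X a l) (ha : 0 < a) (hl : 0 < l) (hu : 0 ≤ u) :
    ∫ ω, Real.exp (-(u * X ω)) ∂μ = l / (l + u ^ a) := by
  rcases hu.eq_or_lt with rfl | hu
  · simp [Real.zero_rpow ha.ne', hl.ne']
  have hrat : AnalyticOnNhd ℝ (fun u : ℝ => l / (l + u ^ a)) (Set.Ioi 0) :=
    analyticOnNhd_const.div (analyticOnNhd_const.add fun v hv =>
      (Real.contDiffAt_rpow_const_of_ne (n := ⊤) (ne_of_gt hv)).analyticAt) fun v hv =>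
        (add_pos hl (Real.rpow_pos_of_pos hv a)).ne'
  have hagree {v : ℝ} (hv : 0 < v) (hlv : l < v ^ a) :
      ∫ ω, Real.exp (-(v * X ω)) ∂μ = l / (l + v ^ a) := by
    rw [h.2.integral_comp h.1 (g := fun x => Real.exp (-(v * x))) (by fun_prop),
      integral_mlDensity_mul_exp_neg_mul ha hv (by rwa [abs_of_pos hl])]
  obtain ⟨u₀, hu₀, hlu₀⟩ : ∃ u₀ : ℝ, 0 < u₀ ∧ l < u₀ ^ a :=
    ((eventually_gt_atTop 0).and ((tendsto_rpow_atTop ha).eventually_gt_atTop l)).exists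
  have hnear : ∀ᶠ v in 𝓝 u₀, ∫ ω, Real.exp (-(v * X ω)) ∂μ = l / (l + v ^ a) := by
    filter_upwards [lt_mem_nhds hu₀, (Real.continuousAt_rpow_const u₀ a
      (Or.inl hu₀.ne')).eventually (lt_mem_nhds hlu₀)] with v hv hlv using hagree hv hlv
  exact (analyticOnNhd_integral_exp_neg_mul h.1.aemeasurable
    (h.ae_pos.mono fun _ => le_of_lt)).eqOn_of_preconnected_of_eventuallyEq hrat
    isPreconnected_Ioi hu₀ hnear hu

end MittagLeffler

theorem exists_le_and_lt_succ {α : Type*} [LinearOrder α] {s : ℕ → α} {t : α} {N : ℕ}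
    (h0 : s 0 ≤ t) (hN : t < s N) : ∃ m < N, s m ≤ t ∧ t < s (m + 1) := by
  induction N with
  | zero => exact absurd hN h0.not_gt
  | succ N ih =>
    rcases le_or_gt (s N) t with h | h
    · exact ⟨N, N.lt_succ_self, h, hN⟩
    · obtain ⟨m, hm, hst⟩ := ih h
      exact ⟨m, hm.trans N.lt_succ_self, hst⟩

section Pathwise

variable {Ω : Type*} {p : ℕ} {C : ℕ → Ω → Fin (p + 1)} {Z : Fin p → ℕ → Ω → ℝ} {ω : Ω}
  {N : ℕ}

/-- The real-valued time spent in the state `C n`; the infinite stay in the absorbing state, where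
no reward is earned, is replaced by `0`. -/
def sojourn (C : ℕ → Ω → Fin (p + 1)) (Z : Fin p → ℕ → Ω → ℝ) (n : ℕ) (ω : Ω) : ℝ :=
  extendLast (Z · n ω) 0 (C n ω)

/-- The time spent in transient states during the first `n` holding times, which is the time of
the `n`-th jump if the chain is not absorbed before. -/
noncomputable def transientTime (C : ℕ → Ω → Fin (p + 1)) (Z : Fin p → ℕ → Ω → ℝ) (n : ℕ) (ω : Ω) :
    ℝ :=
  ∑ k ∈ Finset.range n, sojourn C Z k ω

/-- At `ω`, the chain is in a transient state before its `N`-th step and in the absorbing state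
from then on, and the holding times of the transient states are positive. -/
structure AbsorbedAt (C : ℕ → Ω → Fin (p + 1)) (Z : Fin p → ℕ → Ω → ℝ) (ω : Ω) (N : ℕ) :
    Prop where
  ne_last : ∀ k < N, C k ω ≠ Fin.last p
  eq_last : ∀ k, N ≤ k → C k ω = Fin.last p
  pos : ∀ i k, 0 < Z i k ω

theorem AbsorbedAt.sojourn_pos (h : AbsorbedAt C Z ω N) {k : ℕ} (hk : k < N) :
    0 < sojourn C Z k ω := by
  obtain ⟨i, hi⟩ := Fin.exists_castSucc_eq.2 (h.ne_last k hk)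
  simp [sojourn, ← hi, h.pos]

theorem AbsorbedAt.holdingTime_eq (h : AbsorbedAt C Z ω N) {k : ℕ} (hk : k < N) :
    holdingTime C Z k ω = ENNReal.ofReal (sojourn C Z k ω) := by
  obtain ⟨i, hi⟩ := Fin.exists_castSucc_eq.2 (h.ne_last k hk)
  simp [sojourn, holdingTime, ← hi]

theorem AbsorbedAt.transientTime_nonneg (h : AbsorbedAt C Z ω N) {n : ℕ} (hn : n ≤ N) :
    0 ≤ transientTime C Z n ω :=
  Finset.sum_nonneg fun _ hk => (h.sojourn_pos ((Finset.mem_range.1 hk).trans_le hn)).le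

theorem AbsorbedAt.jumpTime_eq (h : AbsorbedAt C Z ω N) {n : ℕ} (hn : n ≤ N) :
    jumpTime C Z n ω = ENNReal.ofReal (transientTime C Z n ω) := by
  have hlt (k) (hk : k ∈ Finset.range n) : k < N := (Finset.mem_range.1 hk).trans_le hn
  rw [jumpTime, transientTime,
    ENNReal.ofReal_sum_of_nonneg fun k hk => (h.sojourn_pos (hlt k hk)).le]
  exact Finset.sum_congr rfl fun k hk => h.holdingTime_eq (hlt k hk)

theorem jumpTime_mono : Monotone fun n => jumpTime C Z n ω := fun _ _ hmn =>
  Finset.sum_le_sum_of_subset (Finset.range_mono hmn)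

theorem jumpTime_succ_eq_top {n : ℕ} (h : C n ω = Fin.last p) : jumpTime C Z (n + 1) ω = ∞ := by
  simp [jumpTime, Finset.sum_range_succ, holdingTime, h]

theorem semiMarkov_eq {m : ℕ} {t : ℝ} (h₁ : jumpTime C Z m ω ≤ ENNReal.ofReal t)
    (h₂ : ENNReal.ofReal t < jumpTime C Z (m + 1) ω) : semiMarkov C Z t ω = label (C m ω) := by
  rw [semiMarkov, tsum_eq_single m, if_pos ⟨h₁, h₂⟩]
  refine fun n hn => if_neg fun ⟨h₃, h₄⟩ => ?_
  rcases hn.lt_or_gt with hlt | hlt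
  · exact (h₄.trans_le (jumpTime_mono hlt)).not_ge h₁
  · exact (h₂.trans_le (jumpTime_mono hlt)).not_ge h₃

theorem AbsorbedAt.semiMarkov_eq (h : AbsorbedAt C Z ω N) {m : ℕ} (hm : m < N) {t : ℝ}
    (h₁ : transientTime C Z m ω ≤ t) (h₂ : t < transientTime C Z (m + 1) ω) :
    semiMarkov C Z t ω = label (C m ω) := by
  refine FracPH.semiMarkov_eq ?_ ?_
  · rw [h.jumpTime_eq hm.le]
    exact ENNReal.ofReal_le_ofReal h₁
  · rw [h.jumpTime_eq hm]
    exact (ENNReal.ofReal_lt_ofReal_iff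
      (((h.transientTime_nonneg hm.le).trans h₁).trans_lt h₂)).2 h₂

theorem label_injective {m : ℕ} : Function.Injective (label : Fin m → ℕ) := fun _ _ h =>
  Fin.ext (Nat.succ_injective h)

theorem AbsorbedAt.absorptionTime_eq (h : AbsorbedAt C Z ω N) :
    absorptionTime C Z ω = ENNReal.ofReal (transientTime C Z N ω) := by
  refine le_antisymm ?_ ?_
  · refine iInf₂_le _ ⟨h.transientTime_nonneg le_rfl, ?_⟩
    rw [← h.eq_last N le_rfl]
    refine FracPH.semiMarkov_eq (h.jumpTime_eq le_rfl).le ?_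
    rw [jumpTime_succ_eq_top (h.eq_last N le_rfl)]
    exact ENNReal.ofReal_lt_top
  · refine le_iInf₂ fun t ⟨ht0, ht⟩ => ENNReal.ofReal_le_ofReal ?_
    by_contra! hlt
    obtain ⟨m, hm, h₁, h₂⟩ := exists_le_and_lt_succ (s := fun n => transientTime C Z n ω)
      (by simpa [transientTime] using ht0) hlt
    rw [h.semiMarkov_eq hm h₁ h₂] at ht
    exact h.ne_last m hm (label_injective ht)

variable {n : ℕ}

theorem sum_mul_ite_label_eq (f : Fin p → ℝ) (j : Fin (p + 1)) :
    ∑ i : Fin p, f i * (if label j = label i then 1 else 0) = extendLast f 0 j := by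
  have hlabel (i : Fin p) : label j = label i ↔ j = i.castSucc :=
    label_injective.eq_iff (b := i.castSucc)
  cases j using Fin.lastCases with
  | last => simp [hlabel, (Fin.castSucc_ne_last _).symm]
  | cast j => simp [hlabel]

/-- The reward of type `k` earned during the `m`-th sojourn. -/
noncomputable def sojournReward (C : ℕ → Ω → Fin (p + 1)) (Z : Fin p → ℕ → Ω → ℝ)
    (R : Matrix (Fin p) (Fin n) ℝ) (k : Fin n) (m : ℕ) (ω : Ω) : ℝ :=
  extendLast (fun i => R i k * Z i m ω) 0 (C m ω)

theorem extendLast_mul_sojourn (R : Matrix (Fin p) (Fin n) ℝ) (k : Fin n) (m : ℕ) :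
    sojourn C Z m ω * extendLast (R · k) 0 (C m ω) = sojournReward C Z R k m ω := by
  unfold sojourn sojournReward
  cases C m ω using Fin.lastCases <;> simp [mul_comm]

theorem AbsorbedAt.totalReward_eq (h : AbsorbedAt C Z ω N) (R : Matrix (Fin p) (Fin n) ℝ)
    (k : Fin n) : totalReward C Z R k ω = ∑ m ∈ Finset.range N, sojournReward C Z R k m ω := by
  set s : ℕ → ℝ := fun m => transientTime C Z m ω
  set r : ℝ → ℝ := fun t => ∑ i, R i k * (if semiMarkov C Z t ω = label i then 1 else 0)
  have hs_succ (m : ℕ) : s (m + 1) = s m + sojourn C Z m ω := Finset.sum_range_succ ..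
  have hs_le {m : ℕ} (hm : m < N) : s m ≤ s (m + 1) := by
    linarith [hs_succ m, h.sojourn_pos hm]
  have hr {m : ℕ} (hm : m < N) : Set.EqOn (fun _ => extendLast (R · k) 0 (C m ω)) r
      (Set.Ioo (s m) (s (m + 1))) := fun t ht => by
    simp only [r, h.semiMarkov_eq hm ht.1.le ht.2, sum_mul_ite_label_eq]
  have hr_int (m : ℕ) (hm : m < N) : IntervalIntegrable r volume (s m) (s (m + 1)) :=
    intervalIntegrable_const.congr_uIoo (by rw [Set.uIoo_of_le (hs_le hm)]; exact hr hm)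
  calc totalReward C Z R k ω
      = ∫ t in s 0..s N, r t := by
        rw [totalReward, h.absorptionTime_eq, ENNReal.toReal_ofReal (h.transientTime_nonneg le_rfl),
          show s 0 = 0 from Finset.sum_range_zero _]
    _ = ∑ m ∈ Finset.range N, ∫ t in s m..s (m + 1), r t :=
        (intervalIntegral.sum_integral_adjacent_intervals hr_int).symm
    _ = ∑ m ∈ Finset.range N, sojournReward C Z R k m ω := by
        refine Finset.sum_congr rfl fun m hm => ?_
        have hm := Finset.mem_range.1 hm
        rw [← intervalIntegral.integral_congr_Ioo_of_le (hs_le hm) (hr hm),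
          intervalIntegral.integral_const, smul_eq_mul, hs_succ, add_sub_cancel_left,
          extendLast_mul_sojourn]

theorem AbsorbedAt.totalReward_eq_of_le (h : AbsorbedAt C Z ω N) (R : Matrix (Fin p) (Fin n) ℝ)
    (k : Fin n) {M : ℕ} (hM : N ≤ M) :
    totalReward C Z R k ω = ∑ m ∈ Finset.range M, sojournReward C Z R k m ω := by
  rw [h.totalReward_eq]
  refine Finset.sum_subset (Finset.range_mono hM) fun m _ hm => ?_
  rw [sojournReward, h.eq_last m (not_lt.1 (mt Finset.mem_range.2 hm)), extendLast_last]

/-- The factors contributed to `exp (-∑ k, Y k * θ k)` by a sojourn in each of the states, if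
`b = R θ` and `z i` is the holding time in the transient state `i`. -/
noncomputable def laplaceFactor (b z : Fin p → ℝ) : Fin (p + 1) → ℝ :=
  extendLast (fun i => Real.exp (-(b i * z i))) 1

theorem exp_neg_sum_sojournReward (R : Matrix (Fin p) (Fin n) ℝ) (θ : Fin n → ℝ) (m : ℕ) :
    Real.exp (-∑ k, sojournReward C Z R k m ω * θ k)
      = laplaceFactor (R *ᵥ θ) (Z · m ω) (C m ω) := by
  unfold sojournReward laplaceFactor
  cases C m ω using Fin.lastCases with
  | last => simp
  | cast i =>
    simp only [extendLast_castSucc, Matrix.mulVec, dotProduct, Finset.sum_mul, mul_right_comm]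

theorem AbsorbedAt.exp_neg_totalReward (h : AbsorbedAt C Z ω N) (R : Matrix (Fin p) (Fin n) ℝ)
    (θ : Fin n → ℝ) {M : ℕ} (hM : N ≤ M) :
    Real.exp (-∑ k, totalReward C Z R k ω * θ k)
      = ∏ m ∈ Finset.range M, laplaceFactor (R *ᵥ θ) (Z · m ω) (C m ω) := by
  simp_rw [h.totalReward_eq_of_le R _ hM, Finset.sum_mul]
  rw [Finset.sum_comm, ← Finset.sum_neg_distrib, Real.exp_sum]
  exact Finset.prod_congr rfl fun m _ => exp_neg_sum_sojournReward R θ m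

theorem abs_laplaceFactor_le_one {b z : Fin p → ℝ} (hb : ∀ i, 0 ≤ b i) (hz : ∀ i, 0 ≤ z i)
    (j : Fin (p + 1)) : |laplaceFactor b z j| ≤ 1 := by
  refine abs_extendLast_one_le_one (fun i => ?_) j
  rw [Real.abs_exp, Real.exp_le_one_iff, neg_nonpos]
  exact mul_nonneg (hb i) (hz i)

end Pathwise

theorem sum_prod_path_eq_dotProduct_pow_mulVec {ι R : Type*} [Fintype ι] [DecidableEq ι]
    [CommSemiring R] (A : Matrix ι ι R) (v g : ι → R) (n : ℕ) :
    ∑ x : Fin (n + 1) → ι, v (x 0) * (∏ k : Fin n, A (x k.castSucc) (x k.succ)) * g (x (Fin.last n))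
      = v ⬝ᵥ (A ^ n *ᵥ g) := by
  induction n generalizing v with
  | zero =>
    rw [← (Equiv.funUnique (Fin 1) ι).symm.sum_comp]
    simp [Equiv.funUnique, dotProduct]
  | succ n ih =>
    rw [← (Fin.consEquiv fun _ => ι).sum_comp, Fintype.sum_prod_type, pow_succ',
      ← Matrix.mulVec_mulVec, dotProduct]
    refine Finset.sum_congr rfl fun i _ => ?_
    rw [Matrix.mulVec, ← ih, Finset.mul_sum]
    refine Finset.sum_congr rfl fun x _ => ?_
    simp only [Fin.consEquiv_apply, Fin.prod_univ_succ, Fin.cons_zero, Fin.castSucc_zero,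
      Fin.cons_succ, ← Fin.succ_last, ← Fin.succ_castSucc, mul_assoc]

section Chain

variable {Ω : Type*} [MeasurableSpace Ω] {μ : Measure Ω} {m : ℕ}
  {v : Fin m → ℝ} {Q : Matrix (Fin m) (Fin m) ℝ} {C : ℕ → Ω → Fin m}

/-- The path of the chain up to time `n`. -/
def initialPath (C : ℕ → Ω → Fin m) (n : ℕ) (ω : Ω) : Fin (n + 1) → Fin m := fun k => C k ω

/-- The probability that the chain with initial law `v` and transition matrix `Q` starts with the
path `x`. -/
def pathWeight (v : Fin m → ℝ) (Q : Matrix (Fin m) (Fin m) ℝ) {n : ℕ} (x : Fin (n + 1) → Fin m) :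
    ℝ :=
  v (x 0) * ∏ k : Fin n, Q (x k.castSucc) (x k.succ)

theorem IsMarkovChain.measurable_initialPath (hC : IsMarkovChain μ v Q C) (n : ℕ) :
    Measurable (initialPath C n) := measurable_pi_lambda _ fun k => hC.1 k

theorem IsMarkovChain.measureReal_initialPath (hC : IsMarkovChain μ v Q C) {n : ℕ}
    (x : Fin (n + 1) → Fin m) : μ.real (initialPath C n ⁻¹' {x}) = pathWeight v Q x := by
  have hpath : initialPath C n ⁻¹' {x} = {ω | ∀ k ≤ n, C k ω = x (Fin.ofNat (n + 1) k)} := by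
    ext ω
    simp only [Set.mem_preimage, Set.mem_singleton_iff, funext_iff, initialPath, Fin.forall_iff,
      Nat.lt_succ_iff, Set.mem_ofPred_eq]
    refine forall₂_congr fun k hk => ?_
    rw [show Fin.ofNat (n + 1) k = ⟨k, Nat.lt_succ_of_le hk⟩ from Fin.ofNat_val_eq_self ⟨k, _⟩]
  rw [hpath, hC.2 n fun k => x (Fin.ofNat (n + 1) k), ← Fin.prod_univ_eq_prod_range
    (fun k => Q (x (Fin.ofNat (n + 1) k)) (x (Fin.ofNat (n + 1) (k + 1)))) n]
  have hcast (k : Fin n) : Fin.ofNat (n + 1) (k : ℕ) = k.castSucc :=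
    Fin.ofNat_val_eq_self k.castSucc
  have hsucc (k : Fin n) : Fin.ofNat (n + 1) (k + 1 : ℕ) = k.succ := Fin.ofNat_val_eq_self k.succ
  simp only [hcast, hsucc]
  rfl

theorem IsMarkovChain.ae_transition_ne_zero (hC : IsMarkovChain μ v Q C) [IsFiniteMeasure μ] :
    ∀ᵐ ω ∂μ, ∀ n, Q (C n ω) (C (n + 1) ω) ≠ 0 := by
  have hweight : ∀ᵐ ω ∂μ, ∀ n, pathWeight v Q (initialPath C n ω) ≠ 0 := by
    refine ae_all_iff.2 fun n => ?_
    have hx (x : Fin (n + 1) → Fin m) :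
        ∀ᵐ ω ∂μ, pathWeight v Q x = 0 → initialPath C n ω ≠ x := by
      by_cases hx : pathWeight v Q x = 0
      · rw [← hC.measureReal_initialPath, measureReal_eq_zero_iff] at hx
        filter_upwards [measure_eq_zero_iff_ae_notMem.1 hx] with ω hω _ using hω
      · exact .of_forall fun _ h => absurd h hx
    filter_upwards [ae_all_iff.2 hx] with ω hω h using hω _ h rfl
  filter_upwards [hweight] with ω hω n
  exact Finset.prod_ne_zero_iff.1 (right_ne_zero_of_mul (hω (n + 1))) (Fin.last n)
    (Finset.mem_univ _)

theorem IsMarkovChain.integral_comp_initialPath (hC : IsMarkovChain μ v Q C) [IsFiniteMeasure μ]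
    {n : ℕ} (f : (Fin (n + 1) → Fin m) → ℝ) :
    ∫ ω, f (initialPath C n ω) ∂μ = ∑ x, pathWeight v Q x * f x := by
  have hmeas := hC.measurable_initialPath n
  rw [← integral_map hmeas.aemeasurable (measurable_of_countable f).aestronglyMeasurable,
    integral_fintype .of_finite]
  refine Finset.sum_congr rfl fun x _ => ?_
  rw [map_measureReal_apply hmeas (measurableSet_singleton x), hC.measureReal_initialPath,
    smul_eq_mul]

theorem IsMarkovChain.integral_prod_mul (hC : IsMarkovChain μ v Q C) [IsFiniteMeasure μ] (n : ℕ)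
    (φ g : Fin m → ℝ) :
    ∫ ω, (∏ k ∈ Finset.range n, φ (C k ω)) * g (C n ω) ∂μ
      = v ⬝ᵥ ((Matrix.diagonal φ * Q) ^ n *ᵥ g) := by
  simp_rw [← Fin.prod_univ_eq_prod_range (fun k => φ (C k _)) n]
  refine (hC.integral_comp_initialPath fun x =>
    (∏ k : Fin n, φ (x k.castSucc)) * g (x (Fin.last n))).trans ?_
  rw [← sum_prod_path_eq_dotProduct_pow_mulVec]
  refine Finset.sum_congr rfl fun x _ => ?_
  simp only [Matrix.diagonal_mul, Finset.prod_mul_distrib, pathWeight]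
  ring

end Chain

section Absorption

variable {Ω : Type*} [MeasurableSpace Ω] {μ : Measure Ω} [IsFiniteMeasure μ] {p : ℕ}
  {v : Fin (p + 1) → ℝ} {Q : Matrix (Fin (p + 1)) (Fin (p + 1)) ℝ} {C : ℕ → Ω → Fin (p + 1)}

theorem IsMarkovChain.measureReal_ne_last (hC : IsMarkovChain μ v Q C) (n : ℕ) :
    μ.real {ω | C n ω ≠ Fin.last p} = v ⬝ᵥ (Q ^ n *ᵥ extendLast 1 0) := by
  have h := hC.integral_prod_mul n (fun _ => 1) (extendLast 1 0)
  rw [Matrix.diagonal_one, one_mul] at h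
  have hmeas : MeasurableSet {ω | C n ω ≠ Fin.last p} :=
    hC.1 n (measurableSet_singleton (Fin.last p)).compl
  rw [← h, ← integral_indicator_one hmeas]
  congr 1 with ω
  cases hj : C n ω using Fin.lastCases <;> simp [hj]

theorem IsMarkovChain.ae_exists_eq_last (hC : IsMarkovChain μ v Q C)
    (hQ : IsAbsorbingTransitionMatrix Q) : ∀ᵐ ω ∂μ, ∃ n, C n ω = Fin.last p := by
  have hpow := hQ.tendsto_pow_mulVec (φ := fun _ => 1) (by simp) (extendLast_last 1 0)
  rw [Matrix.diagonal_one, one_mul] at hpow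
  have hlim : Tendsto (fun n => μ.real {ω | C n ω ≠ Fin.last p}) atTop (𝓝 0) := by
    simp_rw [hC.measureReal_ne_last]
    have hdot : Continuous fun u => v ⬝ᵥ u := continuous_const.dotProduct continuous_id
    simpa [Function.comp_def] using (hdot.tendsto 0).comp hpow
  rw [ae_iff, ← measureReal_eq_zero_iff]
  refine le_antisymm (ge_of_tendsto' hlim fun n => measureReal_mono fun ω hω => ?_)
    measureReal_nonneg
  exact fun h => hω ⟨n, h⟩

theorem IsMarkovChain.ae_exists_absorbedAt (hC : IsMarkovChain μ v Q C)
    (hQ : IsAbsorbingTransitionMatrix Q) {Z : Fin p → ℕ → Ω → ℝ}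
    (hZ : ∀ᵐ ω ∂μ, ∀ i k, 0 < Z i k ω) : ∀ᵐ ω ∂μ, ∃ N, AbsorbedAt C Z ω N := by
  classical
  filter_upwards [hC.ae_exists_eq_last hQ, hC.ae_transition_ne_zero, hZ] with ω hex hne hpos
  refine ⟨Nat.find hex, fun k hk => Nat.find_min hex hk, fun k hk => ?_, hpos⟩
  induction k, hk using Nat.le_induction with
  | base => exact Nat.find_spec hex
  | succ k _ ih =>
    by_contra hcon
    exact hne k (by rw [ih]; exact hQ.last_apply_of_ne hcon)

end Absorption

theorem integral_comp_eq_integral_integral_of_indepFun {Ω β γ : Type*} [MeasurableSpace Ω]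
    [MeasurableSpace β] [MeasurableSpace γ] {μ : Measure Ω} [IsFiniteMeasure μ] {X : Ω → β}
    {Y : Ω → γ} (hX : Measurable X) (hY : Measurable Y) (h : IndepFun X Y μ) {f : β → γ → ℝ}
    (hf : Measurable fun q : β × γ => f q.1 q.2) (hint : Integrable (fun ω => f (X ω) (Y ω)) μ) :
    ∫ ω, f (X ω) (Y ω) ∂μ = ∫ ω, ∫ ω', f (X ω) (Y ω') ∂μ ∂μ := by
  have hXY := hX.prodMk hY
  have hmap := (indepFun_iff_map_prod_eq_prod_map_map hX.aemeasurable hY.aemeasurable).1 h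
  calc ∫ ω, f (X ω) (Y ω) ∂μ
      = ∫ q, f q.1 q.2 ∂((μ.map X).prod (μ.map Y)) := by
        rw [← hmap, integral_map hXY.aemeasurable hf.aestronglyMeasurable]
    _ = ∫ x, ∫ y, f x y ∂(μ.map Y) ∂(μ.map X) := by
        refine integral_prod _ ?_
        rw [← hmap]
        exact (integrable_map_measure hf.aestronglyMeasurable hXY.aemeasurable).2 hint
    _ = ∫ ω, ∫ y, f (X ω) y ∂(μ.map Y) ∂μ :=
        integral_map hX.aemeasurable
          hf.stronglyMeasurable.integral_prod_right'.aestronglyMeasurable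
    _ = ∫ ω, ∫ ω', f (X ω) (Y ω') ∂μ ∂μ :=
        integral_congr_ae (.of_forall fun ω => integral_map hY.aemeasurable
          (hf.comp measurable_prodMk_left).aestronglyMeasurable)

theorem measurable_comp_of_countable {Ω ι β : Type*} [MeasurableSpace Ω] [MeasurableSpace ι]
    [MeasurableSpace β] [Countable ι] [MeasurableSingletonClass ι] {g : ι → Ω → β} {N : Ω → ι}
    (hg : ∀ j, Measurable (g j)) (hN : Measurable N) : Measurable fun ω => g (N ω) ω :=
  (measurable_from_prod_countable_right (f := fun q : ι × Ω => g q.1 q.2) hg).comp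
    (hN.prodMk measurable_id)

theorem abs_prod_le_one {ι : Type*} {s : Finset ι} {f : ι → ℝ} (h : ∀ i ∈ s, |f i| ≤ 1) :
    |∏ i ∈ s, f i| ≤ 1 := by
  rw [Finset.abs_prod]
  exact Finset.prod_le_one (fun i _ => abs_nonneg _) h

theorem extendLast_one_eq_prod {p : ℕ} (f : Fin p → ℝ) (j : Fin (p + 1)) :
    extendLast f 1 j = ∏ i, if i.castSucc = j then f i else 1 := by
  cases j using Fin.lastCases <;> simp

section Reward

variable {Ω : Type*} [MeasurableSpace Ω] {μ : Measure Ω} {p n : ℕ} {C : ℕ → Ω → Fin (p + 1)}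
  {Z : Fin p → ℕ → Ω → ℝ} {b L : Fin p → ℝ}

theorem measurable_sojournReward (hC : ∀ m, Measurable (C m)) (hZ : ∀ i m, Measurable (Z i m))
    (R : Matrix (Fin p) (Fin n) ℝ) (k : Fin n) (m : ℕ) : Measurable (sojournReward C Z R k m) :=
  measurable_comp_of_countable (g := fun j ω => extendLast (fun i => R i k * Z i m ω) 0 j)
    (measurable_extendLast (fun i => (hZ i m).const_mul (R i k)) 0) (hC m)

theorem aemeasurable_totalReward (hC : ∀ m, Measurable (C m)) (hZ : ∀ i m, Measurable (Z i m))
    (habs : ∀ᵐ ω ∂μ, ∃ N, AbsorbedAt C Z ω N) (R : Matrix (Fin p) (Fin n) ℝ) (k : Fin n) :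
    AEMeasurable (totalReward C Z R k) μ := by
  refine aemeasurable_of_tendsto_metrizable_ae atTop
    (f := fun M ω => ∑ m ∈ Finset.range M, sojournReward C Z R k m ω) (fun M =>
      (Finset.measurable_fun_sum _ fun m _ => measurable_sojournReward hC hZ R k m).aemeasurable) ?_
  filter_upwards [habs] with ω ⟨N, hN⟩
  exact tendsto_atTop_of_eventually_const fun M hM => (hN.totalReward_eq_of_le R k hM).symm

theorem measurable_prod_laplaceFactor (hC : ∀ m, Measurable (C m))
    (hZ : ∀ i m, Measurable (Z i m)) (b : Fin p → ℝ) (M : ℕ) :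
    Measurable fun ω => ∏ k ∈ Finset.range M, laplaceFactor b (Z · k ω) (C k ω) := by
  refine Finset.measurable_fun_prod _ fun k _ => measurable_comp_of_countable
    (measurable_extendLast (fun i => ?_) 1) (hC k)
  exact ((hZ i k).const_mul (b i)).neg.exp

theorem ae_abs_prod_laplaceFactor_le_one (hpos : ∀ᵐ ω ∂μ, ∀ i k, 0 < Z i k ω)
    (hb : ∀ i, 0 ≤ b i) (M : ℕ) :
    ∀ᵐ ω ∂μ, |∏ k ∈ Finset.range M, laplaceFactor b (Z · k ω) (C k ω)| ≤ 1 := by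
  filter_upwards [hpos] with ω hω
  exact abs_prod_le_one fun k _ => abs_laplaceFactor_le_one hb (fun i => (hω i k).le) _

theorem tendsto_integral_prod_laplaceFactor [IsFiniteMeasure μ] (hC : ∀ m, Measurable (C m))
    (hZ : ∀ i m, Measurable (Z i m)) (hpos : ∀ᵐ ω ∂μ, ∀ i k, 0 < Z i k ω)
    (habs : ∀ᵐ ω ∂μ, ∃ N, AbsorbedAt C Z ω N) {R : Matrix (Fin p) (Fin n) ℝ} {θ : Fin n → ℝ}
    (hRθ : ∀ i, 0 ≤ (R *ᵥ θ) i) :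
    Tendsto (fun M => ∫ ω, ∏ k ∈ Finset.range M, laplaceFactor (R *ᵥ θ) (Z · k ω) (C k ω) ∂μ)
      atTop (𝓝 (∫ ω, Real.exp (-∑ k, totalReward C Z R k ω * θ k) ∂μ)) := by
  refine tendsto_integral_of_dominated_convergence (fun _ => 1)
    (fun M => (measurable_prod_laplaceFactor hC hZ _ M).aestronglyMeasurable)
    (integrable_const _) (fun M => ae_abs_prod_laplaceFactor_le_one hpos hRθ M) ?_
  filter_upwards [habs] with ω ⟨N, hN⟩
  exact tendsto_atTop_of_eventually_const fun M hM => (hN.exp_neg_totalReward R θ hM).symm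

theorem integral_prod_laplaceFactor_of_path (hZ : ∀ i k, Measurable (Z i k))
    (hL : ∀ i k, ∫ ω, Real.exp (-(b i * Z i k ω)) ∂μ = L i)
    (hZind : iIndepFun (fun a : Fin p × ℕ => Z a.1 a.2) μ) (c : ℕ → Fin (p + 1)) (M : ℕ) :
    ∫ ω, ∏ k ∈ Finset.range M, laplaceFactor b (Z · k ω) (c k) ∂μ
      = ∏ k ∈ Finset.range M, extendLast L 1 (c k) := by
  have := hZind.isProbabilityMeasure
  set g : Fin p × Fin M → ℝ → ℝ := fun a z =>
    if a.1.castSucc = c a.2 then Real.exp (-(b a.1 * z)) else 1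
  have hind : iIndepFun (fun a : Fin p × Fin M => Z a.1 a.2) μ :=
    hZind.precomp (Function.injective_id.prodMap Fin.val_injective)
  have hg (a : Fin p × Fin M) : Measurable (g a) := by
    unfold g
    split_ifs <;> fun_prop
  have hg_int (a : Fin p × Fin M) :
      ∫ ω, g a (Z a.1 a.2 ω) ∂μ = if a.1.castSucc = c a.2 then L a.1 else 1 := by
    unfold g
    split_ifs <;> simp [hL]
  simp only [laplaceFactor, extendLast_one_eq_prod, ← Fin.prod_univ_eq_prod_range]
  simpa only [hg_int, Fintype.prod_prod_type_right] using hind.integral_fun_prod_comp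
    (fun a => (hZ a.1 a.2).aemeasurable) fun a => (hg a).aestronglyMeasurable

theorem integral_prod_laplaceFactor (hC : ∀ m, Measurable (C m))
    (hZ : ∀ i k, Measurable (Z i k)) (hpos : ∀ᵐ ω ∂μ, ∀ i k, 0 < Z i k ω) (hb : ∀ i, 0 ≤ b i)
    (hL : ∀ i k, ∫ ω, Real.exp (-(b i * Z i k ω)) ∂μ = L i)
    (hZind : iIndepFun (fun a : Fin p × ℕ => Z a.1 a.2) μ)
    (hCZ : IndepFun (fun ω m => C m ω) (fun ω (a : Fin p × ℕ) => Z a.1 a.2 ω) μ) (M : ℕ) :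
    ∫ ω, ∏ k ∈ Finset.range M, laplaceFactor b (Z · k ω) (C k ω) ∂μ
      = ∫ ω, ∏ k ∈ Finset.range M, extendLast L 1 (C k ω) ∂μ := by
  have := hZind.isProbabilityMeasure
  have hint : Integrable (fun ω => ∏ k ∈ Finset.range M, laplaceFactor b (Z · k ω) (C k ω)) μ :=
    .of_bound (measurable_prod_laplaceFactor hC hZ b M).aestronglyMeasurable 1
      (ae_abs_prod_laplaceFactor_le_one hpos hb M)
  rw [integral_comp_eq_integral_integral_of_indepFun (measurable_pi_lambda _ hC)
    (measurable_pi_lambda _ fun a : Fin p × ℕ => hZ a.1 a.2) hCZ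
    (f := fun c z => ∏ k ∈ Finset.range M, laplaceFactor b (fun i => z (i, k)) (c k))
    (measurable_prod_laplaceFactor (fun k => (measurable_pi_apply k).comp measurable_fst)
      (fun i k => (measurable_pi_apply (i, k)).comp measurable_snd) b M) hint]
  simp_rw [integral_prod_laplaceFactor_of_path hZ hL hZind]

end Reward

theorem IsMarkovChain.tendsto_integral_prod_holdingLaplace {Ω : Type*} [MeasurableSpace Ω]
    {μ : Measure Ω} [IsFiniteMeasure μ] {p : ℕ} {lam d w : Fin p → ℝ}
    {Q : Matrix (Fin (p + 1)) (Fin (p + 1)) ℝ} {C : ℕ → Ω → Fin (p + 1)}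
    (hC : IsMarkovChain μ (initialLaw w) Q C) (hQ : IsAbsorbingTransitionMatrix Q)
    (hd : ∀ i, lam i + d i ≠ 0) (hle : ∀ i, |lam i / (lam i + d i)| ≤ 1) :
    Tendsto (fun M => ∫ ω, ∏ k ∈ Finset.range M, holdingLaplace lam d (C k ω) ∂μ) atTop
      (𝓝 (w ⬝ᵥ ((Matrix.diagonal d - subIntensity lam Q)⁻¹ *ᵥ exitRates lam Q))) := by
  have hval (M : ℕ) : ∫ ω, ∏ k ∈ Finset.range M, holdingLaplace lam d (C k ω) ∂μ
      = initialLaw w ⬝ᵥ ((Matrix.diagonal (holdingLaplace lam d) * Q) ^ M *ᵥ 1) := by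
    simpa using hC.integral_prod_mul M (holdingLaplace lam d) 1
  have hdot : Continuous fun u => initialLaw w ⬝ᵥ u := continuous_const.dotProduct continuous_id
  simp_rw [hval, ← initialLaw_dotProduct_extendLast w _ 1]
  exact (hdot.tendsto _).comp (hQ.tendsto_pow_mulVec_one hd hle)

theorem integral_exp_neg_mul_mem_Ioc {Ω : Type*} [MeasurableSpace Ω] {μ : Measure Ω}
    [IsProbabilityMeasure μ] {X : Ω → ℝ} (hX : Measurable X) (hpos : ∀ᵐ ω ∂μ, 0 < X ω) {u : ℝ}
    (hu : 0 ≤ u) : ∫ ω, Real.exp (-(u * X ω)) ∂μ ∈ Set.Ioc 0 1 := by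
  have hle : ∀ᵐ ω ∂μ, Real.exp (-(u * X ω)) ≤ 1 := by
    filter_upwards [hpos] with ω hω
    exact Real.exp_le_one_iff.2 (neg_nonpos.2 (mul_nonneg hu hω.le))
  have hint : Integrable (fun ω => Real.exp (-(u * X ω))) μ :=
    .of_bound (hX.const_mul u).neg.exp.aestronglyMeasurable 1
      (by simpa only [Real.norm_eq_abs, Real.abs_exp] using hle)
  exact ⟨integral_exp_pos hint, by simpa using integral_mono_ae hint (integrable_const 1) hle⟩

end FracPH

-- Any law on `(0, ∞)` with Laplace transform `L` is covered, with `ψ u = λ (1 / L u - 1)`.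
theorem mainTheorem4_general {Ω : Type*} [MeasurableSpace Ω] (μ : Measure Ω)
    [IsProbabilityMeasure μ] (p n : ℕ) (lam : Fin p → ℝ)
    (Q : Matrix (Fin (p + 1)) (Fin (p + 1)) ℝ) (hQ : IsAbsorbingTransitionMatrix Q)
    (w : Fin p → ℝ) (C : ℕ → Ω → Fin (p + 1)) (hC : IsMarkovChain μ (initialLaw w) Q C)
    (Z : Fin p → ℕ → Ω → ℝ) (hZ : ∀ i m, Measurable (Z i m))
    (hpos : ∀ i m, ∀ᵐ ω ∂μ, 0 < Z i m ω) (ψ : Fin p → ℝ → ℝ)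
    (hψ : ∀ i m u, 0 ≤ u → ∫ ω, Real.exp (-(u * Z i m ω)) ∂μ = lam i / (lam i + ψ i u))
    (hZind : iIndepFun (fun (a : Fin p × ℕ) => Z a.1 a.2) μ)
    (hCZ : IndepFun (fun ω (m : ℕ) => C m ω) (fun ω (a : Fin p × ℕ) => Z a.1 a.2 ω) μ)
    (R : Matrix (Fin p) (Fin n) ℝ) (hR : ∀ i k, 0 ≤ R i k) :
    (∀ᵐ ω ∂μ, absorptionTime C Z ω < ∞) ∧
    (∀ k, AEMeasurable (totalReward C Z R k) μ) ∧
    ∀ θ : Fin n → ℝ, (∀ k, 0 ≤ θ k) →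
      IsUnit (Matrix.diagonal (fun i => ψ i (R.mulVec θ i)) - subIntensity lam Q) ∧
      ∫ ω, Real.exp (-∑ k, totalReward C Z R k ω * θ k) ∂μ =
        w ⬝ᵥ ((Matrix.diagonal (fun i => ψ i (R.mulVec θ i)) - subIntensity lam Q)⁻¹.mulVec
          (exitRates lam Q)) := by
  have hpos' : ∀ᵐ ω ∂μ, ∀ i m, 0 < Z i m ω := ae_all_iff.2 fun i => ae_all_iff.2 (hpos i)
  have habs := hC.ae_exists_absorbedAt hQ hpos'
  refine ⟨?_, aemeasurable_totalReward hC.1 hZ habs R, fun θ hθ => ?_⟩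
  · filter_upwards [habs] with ω ⟨N, hN⟩
    exact hN.absorptionTime_eq ▸ ENNReal.ofReal_lt_top
  have hRθ (i : Fin p) : 0 ≤ R.mulVec θ i :=
    dotProduct_nonneg_of_nonneg (hR i) hθ
  have hL (i : Fin p) (m : ℕ) := hψ i m _ (hRθ i)
  have hmem (i : Fin p) : lam i / (lam i + ψ i (R.mulVec θ i)) ∈ Set.Ioc 0 1 :=
    hL i 0 ▸ integral_exp_neg_mul_mem_Ioc (hZ i 0) (hpos i 0) (hRθ i)
  have hd (i : Fin p) : lam i + ψ i (R.mulVec θ i) ≠ 0 := (div_ne_zero_iff.1 (hmem i).1.ne').2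
  have hle (i : Fin p) : |lam i / (lam i + ψ i (R.mulVec θ i))| ≤ 1 :=
    (abs_of_pos (hmem i).1).trans_le (hmem i).2
  refine ⟨hQ.isUnit_diagonal_sub_subIntensity hd hle, ?_⟩
  have hlim := tendsto_integral_prod_laplaceFactor hC.1 hZ hpos' habs hRθ
  simp_rw [integral_prod_laplaceFactor hC.1 hZ hpos' hRθ hL hZind hCZ] at hlim
  exact tendsto_nhds_unique hlim (hC.tendsto_integral_prod_holdingLaplace hQ hd hle)

theorem mainTheorem4 {Ω : Type*} [MeasurableSpace Ω] (μ : Measure Ω) [IsProbabilityMeasure μ]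
    (p n : ℕ) (α : ℝ) (hα0 : 0 < α) (hα1 : α ≤ 1)
    (lam : Fin p → ℝ) (hlam : ∀ i, 0 < lam i)
    (Q : Matrix (Fin (p + 1)) (Fin (p + 1)) ℝ) (hQ : IsAbsorbingTransitionMatrix Q)
    (w : Fin p → ℝ) (hw : ∀ i, 0 ≤ w i) (hw1 : ∑ i, w i = 1)
    (C : ℕ → Ω → Fin (p + 1)) (hC : IsMarkovChain μ (initialLaw w) Q C)
    (Z : Fin p → ℕ → Ω → ℝ) (hZ : ∀ i m, IsMittagLeffler μ (Z i m) α (lam i))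
    (hZind : iIndepFun (fun (a : Fin p × ℕ) => Z a.1 a.2) μ)
    (hCZ : IndepFun (fun ω (m : ℕ) => C m ω) (fun ω (a : Fin p × ℕ) => Z a.1 a.2 ω) μ)
    (R : Matrix (Fin p) (Fin n) ℝ) (hR : ∀ i k, 0 ≤ R i k) :
    (∀ᵐ ω ∂μ, absorptionTime C Z ω < ∞) ∧
    (∀ k, AEMeasurable (totalReward C Z R k) μ) ∧
    ∀ θ : Fin n → ℝ, (∀ k, 0 ≤ θ k) →
      IsUnit (Matrix.diagonal (fun i => (R.mulVec θ i) ^ α) - subIntensity lam Q) ∧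
      ∫ ω, Real.exp (-∑ k, totalReward C Z R k ω * θ k) ∂μ =
        w ⬝ᵥ ((Matrix.diagonal (fun i => (R.mulVec θ i) ^ α) - subIntensity lam Q)⁻¹.mulVec
          (exitRates lam Q)) :=
  mainTheorem4_general μ p n lam Q hQ w C hC Z (fun i m => (hZ i m).1) (fun i m => (hZ i m).ae_pos)
    (fun _ u => u ^ α) (fun i m _ => (hZ i m).integral_exp_neg_mul hα0 (hlam i)) hZind hCZ R hR
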